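/- Let $(W,S)$ be a finite, irreducible Coxeter system, with set of reflections $T=\bigcup_{w\in W} wSw^{-1}$, rank $\mathrm{rank}(W)=|S|$, and longest element $w_0$ (the unique element of maximal length with respect to $S$). For $w\in W$ let $\ell_T(w)$ be the smallest $k$ such that $w$ is a product of $k$ elements of $T$; write $v\le_T w$ if $\ell_T(v)+\ell_T(v^{-1}w)=\ell_T(w)$, and $[1,w]_T=\{v\in W : 1\le_T v\le_T w\}$. Let $P(w)$ denote the parabolic closure of $w$, i.e. the smallest subgroup of the form $x\langle I\rangle x^{-1}$ with $I\subseteq S$ and $x\in W$ that contains $w$. Let $u\in W$ satisfy $u^2=1$ and $u\neq 1$. The following are equivalent: 1. $P(u)=W$; 2. $t\le_T u$ for all $t\in T$; 3. $u\in Z(W)$, the center of $W$; 4. $\ell_T(u)=\mathrm{rank}(W)$. If these conditions hold, then $u=w_0$ and $[1,u]_T=\{v\in W : v^2=1\}$. -/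

import Mathlib

/-!
All four conditions are read off the moved spaces `Mov(w) = im(ρ(w) - 1)` of the geometric
representation `ρ` of `W` on `V = ℝ^S`. Carter's lemma says `ℓ_T(w) = dim Mov(w)`: reflections move
a line, so `dim Mov(w) ≤ ℓ_T(w)`, and conversely some reflection `t` lowers `dim Mov` as long as
`w ≠ 1`. Such a `t` comes from conjugating `w` into a standard parabolic `W_I` with `I` minimal:
the stabilizer in `W_I` of a dominant vector is standard parabolic, so minimality forces every
vector fixed by `w` to be orthogonal to all `αᵢ`, `i ∈ I`, that is, `αᵢ ∈ Mov(w)`. The same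
conjugate shows that `P(w) = W` iff `Mov(w) = V`.

An involution `u` has `Mov(u) = ker(ρ(u) + 1)`, so the conditions on `P(u)` and `ℓ_T(u)` both say
`ρ(u) = -1`. A central element commutes with each `sᵢ`, hence has every `αᵢ` as an eigenvector,
with one common eigenvalue because the Coxeter graph is connected. If `ρ(u) = -1`, then `u`
exchanges positive and negative roots, which gives `ℓ(uv) + ℓ(v) = ℓ(u)` for all `v`. Moreover
`Mov(v⁻¹u) = im(ρ(v) + 1)`, and the dimensions of `im(ρ(v) - 1)` and `im(ρ(v) + 1)`, which together
span `V`, add up to `dim V` exactly when `v² = 1`.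
-/

namespace CoxeterMatrix

/-- The Coxeter graph: two distinct vertices are joined iff `m(i, j) ≠ 2`, that is, iff
`m(i, j) ≥ 3` or `m(i, j) = ∞` (Mathlib encodes `∞` as `0`). -/
def coxeterGraph {B : Type*} (M : CoxeterMatrix B) : SimpleGraph B where
  Adj i j := i ≠ j ∧ M i j ≠ 2
  symm := ⟨fun i j h => ⟨h.1.symm, by rw [M.symmetric]; exact h.2⟩⟩
  loopless := ⟨fun _ h => h.1 rfl⟩

end CoxeterMatrix

namespace CoxeterSystem

variable {B W : Type*} [Group W] {M : CoxeterMatrix B} (cs : CoxeterSystem M W)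

/-- The Coxeter system is irreducible: its Coxeter graph is connected (and nonempty). -/
def IsIrreducible (_cs : CoxeterSystem M W) : Prop := M.coxeterGraph.Connected

/-- The rank of a Coxeter system: the number of its simple reflections. -/
noncomputable def rank (_cs : CoxeterSystem M W) : ℕ := Nat.card B

/-- The reflection length `ℓ_T(w)`: the smallest number of reflections with product `w`. -/
noncomputable def reflectionLength (w : W) : ℕ :=
  sInf {k | ∃ l : List W, (∀ t ∈ l, cs.IsReflection t) ∧ l.prod = w ∧ l.length = k}

/-- The infimum defining the reflection length is attained. -/
theorem exists_reflectionLength (w : W) :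
    ∃ l : List W, (∀ t ∈ l, cs.IsReflection t) ∧ l.prod = w ∧
      l.length = cs.reflectionLength w := by
  refine Nat.sInf_mem
    (s := {k | ∃ l : List W, (∀ t ∈ l, cs.IsReflection t) ∧ l.prod = w ∧ l.length = k}) ?_
  obtain ⟨ω, rfl⟩ := cs.wordProd_surjective w
  refine ⟨_, ω.map cs.simple, ?_, rfl, rfl⟩
  intro t ht
  obtain ⟨i, -, rfl⟩ := List.mem_map.1 ht
  exact cs.isReflection_simple i

/-- The absolute order: `u ≤_T v` iff `ℓ_T(u) + ℓ_T(u⁻¹ v) = ℓ_T(v)`. -/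
def AbsLE (u v : W) : Prop :=
  cs.reflectionLength u + cs.reflectionLength (u⁻¹ * v) = cs.reflectionLength v

/-- The interval `[u, v]_T` of the absolute order. -/
def absInterval (u v : W) : Set W := {w | cs.AbsLE u w ∧ cs.AbsLE w v}

/-- The standard parabolic subgroup `W_I` generated by the simple reflections in `I`. -/
def standardParabolic (I : Set B) : Subgroup W := Subgroup.closure (cs.simple '' I)

/-- A parabolic subgroup is a conjugate `w W_I w⁻¹` of a standard parabolic subgroup. -/
def IsParabolic (P : Subgroup W) : Prop :=
  ∃ (I : Set B) (w : W), P = (cs.standardParabolic I).map (MulAut.conj w).toMonoidHom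

/-- The parabolic closure `P(w)`: the intersection of all parabolic subgroups containing `w`.
Intersections of parabolic subgroups being parabolic, it is the smallest one containing `w`. -/
def parabolicClosure (w : W) : Subgroup W := sInf {P | cs.IsParabolic P ∧ w ∈ P}

/-- `P(w) = W` holds iff `W` itself is the smallest parabolic subgroup containing `w`. -/
theorem parabolicClosure_eq_top_iff (w : W) :
    cs.parabolicClosure w = ⊤ ↔ IsLeast {P | cs.IsParabolic P ∧ w ∈ P} ⊤ := by
  constructor
  · intro h
    refine ⟨⟨⟨Set.univ, 1, ?_⟩, Subgroup.mem_top w⟩, fun P hP => h ▸ sInf_le hP⟩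
    rw [standardParabolic, Set.image_univ, cs.subgroup_closure_range_simple]
    exact (Subgroup.map_top_of_surjective _ (MulAut.conj (1 : W)).surjective).symm
  · intro h
    exact top_le_iff.1 (le_sInf h.2)

/-- `w` is the longest element: every other element has strictly smaller length `ℓ_S`. -/
def IsLongestElement (w : W) : Prop := ∀ v : W, v ≠ w → cs.length v < cs.length w

end CoxeterSystem

namespace CoxeterGeometry

open Module Polynomial.Chebyshev

section Trigonometry

theorem S_eval_two_mul_cos_pi_div_nonneg {m : ℕ} {k : ℤ} (hm : m ≠ 1) (hk : -1 ≤ k)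
    (hkm : m ≠ 0 → k + 1 ≤ m) : 0 ≤ (S ℝ k).eval (2 * Real.cos (Real.pi / m)) := by
  have hk' : (0 : ℝ) ≤ k + 1 := by exact_mod_cast (by lia : 0 ≤ k + 1)
  rcases eq_or_ne m 0 with rfl | hm0
  · simpa using hk'
  have hm2 : (2 : ℝ) ≤ m := by exact_mod_cast (by lia : 2 ≤ m)
  have hkm' : (k + 1 : ℝ) ≤ m := by exact_mod_cast hkm hm0
  have hsin : 0 < Real.sin (Real.pi / m) := by
    apply Real.sin_pos_of_pos_of_lt_pi (by positivity)
    rw [div_lt_iff₀ (by linarith)]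
    nlinarith [Real.pi_pos]
  refine nonneg_of_mul_nonneg_left ?_ hsin
  rw [S_two_mul_real_cos]
  apply Real.sin_nonneg_of_nonneg_of_le_pi (by positivity)
  rw [← mul_div_assoc, div_le_iff₀ (by linarith)]
  nlinarith [Real.pi_pos]

theorem two_mul_cos_pi_div_ne_zero {m : ℕ} (hm : m ≠ 2) : 2 * Real.cos (Real.pi / m) ≠ 0 := by
  rcases eq_or_ne m 0 with rfl | h0
  · simp
  rcases eq_or_ne m 1 with rfl | h1
  · simp
  have hm3 : (3 : ℝ) ≤ m := by exact_mod_cast (by lia : 3 ≤ m)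
  have hlt : Real.pi / m < Real.pi / 2 := by gcongr; linarith
  have hpos : 0 < Real.pi / m := by positivity
  have := Real.cos_pos_of_mem_Ioo ⟨by linarith, hlt⟩
  positivity

end Trigonometry

section Reflections

theorem reflection_mul_reflection_sq_eq_one {R V : Type*} [CommRing R] [AddCommGroup V]
    [Module R V] {x y : V} {f g : Dual R V} (hf : f x = 2) (hg : g y = 2) (hfy : f y = 0)
    (hgx : g x = 0) : (reflection hf * reflection hg) ^ 2 = 1 := by
  ext z
  simp only [sq, LinearEquiv.mul_apply, reflection_apply, map_sub, map_smul, hfy, hgx, hf, hg,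
    LinearEquiv.coe_one, id]
  module

variable {V : Type*} [AddCommGroup V] [Module ℝ V] {x y : V} {f g : Dual ℝ V}

theorem reflection_mul_reflection_pow_eq_one (hf : f x = 2) (hg : g y = 2) {m : ℕ} (hm : 3 ≤ m)
    (hfg : f y * g x = 4 * Real.cos (Real.pi / m) ^ 2) :
    (reflection hf * reflection hg) ^ m = 1 := by
  have hm3 : (3 : ℝ) ≤ m := by exact_mod_cast hm
  set φ : ℝ := 2 * (Real.pi / m) with hφ
  have hsin : Real.sin φ ≠ 0 := by
    refine (Real.sin_pos_of_pos_of_lt_pi (by positivity) ?_).ne'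
    rw [hφ, ← mul_div_assoc, div_lt_iff₀ (by linarith)]
    nlinarith [Real.pi_pos]
  have htrace : 2 * Real.cos φ = f y * g x - 2 := by
    rw [hfg, hφ, Real.cos_two_mul]; ring
  ext z
  rw [reflection_mul_reflection_pow_apply hf hg m z _ htrace]
  obtain ⟨k, hk | hk⟩ := Nat.even_or_odd' m
  · have hS : (S ℝ (k - 1)).eval (2 * Real.cos φ) = 0 := by
      have hangle : (((k - 1 : ℤ) : ℝ) + 1) * φ = Real.pi := by
        have : (k : ℝ) ≠ 0 := by exact_mod_cast (by lia : k ≠ 0)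
        rw [hφ, hk]; push_cast; field_simp; ring
      refine (mul_eq_zero.1 ?_).resolve_right hsin
      rw [S_two_mul_real_cos, hangle, Real.sin_pi]
    have h₁ : ((m : ℤ) - 2) / 2 = k - 1 := by lia
    have h₂ : ((m : ℤ) - 1) / 2 = k - 1 := by lia
    simp [h₁, h₂, hS]
  · have hS : (S ℝ k).eval (2 * Real.cos φ) + (S ℝ (k - 1)).eval (2 * Real.cos φ) = 0 := by
      have hangle : (((k : ℤ) : ℝ) + 1) * φ = 2 * Real.pi - (((k - 1 : ℤ) : ℝ) + 1) * φ := by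
        have : (2 * (k : ℝ) + 1) ≠ 0 := by positivity
        rw [hφ, hk]; push_cast; field_simp; ring
      refine (mul_eq_zero.1 ?_).resolve_right hsin
      rw [add_mul, S_two_mul_real_cos, S_two_mul_real_cos, hangle, Real.sin_two_pi_sub,
        neg_add_cancel]
    have h₁ : ((m : ℤ) - 2) / 2 = k - 1 := by lia
    have h₂ : ((m : ℤ) - 1) / 2 = k := by lia
    have h₃ : ((m : ℤ) - 3) / 2 = k - 1 := by lia
    have h₄ : (m : ℤ) / 2 = k := by lia
    simp [h₁, h₂, h₃, h₄, hS]

end Reflections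

section Involution

variable {k V : Type*} [Field k] [NeZero (2 : k)] [AddCommGroup V] [Module k V] {f : End k V}

theorem range_sub_one_eq_ker_add_one (hf : f ^ 2 = 1) :
    LinearMap.range (f - 1) = LinearMap.ker (f + 1) := by
  have hmul : (f + 1) * (f - 1) = 0 := by
    rw [show (f + 1) * (f - 1) = f ^ 2 - 1 by noncomm_ring, hf, sub_self]
  refine le_antisymm (LinearMap.range_le_ker_iff.2 hmul) fun x hx => ⟨-(2 : k)⁻¹ • x, ?_⟩
  have hfx : f x = -x := eq_neg_of_add_eq_zero_left hx
  have hhalf : (2 : k)⁻¹ * 2 = 1 := inv_mul_cancel₀ (NeZero.ne 2)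
  simp only [LinearMap.sub_apply, map_smul, hfx, End.one_apply]
  linear_combination (norm := module) hhalf • x

theorem range_add_one_eq_ker_sub_one (hf : f ^ 2 = 1) :
    LinearMap.range (f + 1) = LinearMap.ker (f - 1) := by
  have h := range_sub_one_eq_ker_add_one (f := -f) (by rwa [neg_sq])
  rwa [show -f - 1 = -(f + 1) by abel, show -f + 1 = -(f - 1) by abel, LinearMap.range_neg,
    LinearMap.ker_neg] at h

theorem range_sub_one_sup_range_add_one (f : End k V) :
    LinearMap.range (f - 1) ⊔ LinearMap.range (f + 1) = ⊤ := by
  refine Submodule.eq_top_iff'.2 fun x => ?_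
  have hx : x = (f - 1) (-(2 : k)⁻¹ • x) + (f + 1) ((2 : k)⁻¹ • x) := by
    have hhalf : (2 : k)⁻¹ * 2 = 1 := inv_mul_cancel₀ (NeZero.ne 2)
    simp only [LinearMap.sub_apply, LinearMap.add_apply, map_smul, End.one_apply]
    linear_combination (norm := module) -hhalf • x
  rw [hx]
  exact Submodule.add_mem_sup ⟨_, rfl⟩ ⟨_, rfl⟩

theorem sq_eq_one_of_disjoint_range {R V : Type*} [Ring R] [AddCommGroup V] [Module R V]
    {f : End R V} (hf : Disjoint (LinearMap.range (f - 1)) (LinearMap.range (f + 1))) :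
    f ^ 2 = 1 := by
  ext x
  have h₁ : f (f x) - x ∈ LinearMap.range (f - 1) := ⟨f x + x, by simp; abel⟩
  have h₂ : f (f x) - x ∈ LinearMap.range (f + 1) := ⟨f x - x, by simp⟩
  rw [sq, End.mul_apply, End.one_apply]
  exact sub_eq_zero.1 (Submodule.disjoint_def.1 hf _ h₁ h₂)

theorem finrank_range_sub_one_add_finrank_range_add_one_iff [FiniteDimensional k V] :
    finrank k (LinearMap.range (f - 1)) + finrank k (LinearMap.range (f + 1)) = finrank k V ↔
      f ^ 2 = 1 := by
  refine ⟨fun hdim => sq_eq_one_of_disjoint_range ?_, fun hf => ?_⟩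
  · have hsum := Submodule.finrank_sup_add_finrank_inf_eq
      (LinearMap.range (f - 1)) (LinearMap.range (f + 1))
    rw [range_sub_one_sup_range_add_one, finrank_top, hdim] at hsum
    exact disjoint_iff.2 (Submodule.finrank_eq_zero.1 (by lia))
  · rw [range_add_one_eq_ker_sub_one hf, LinearMap.finrank_range_add_finrank_ker]

end Involution

section MovedSpace

variable {k G V : Type*} [Field k] [Group G] [AddCommGroup V] [Module k V]
  (ρ : Representation k G V)

/-- The moved space `Mov(g) = im(ρ g - 1)` of a group element `g` acting through `ρ`. -/
def movedSpace (g : G) : Submodule k V := LinearMap.range (ρ g - 1)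

variable {ρ}

theorem mem_movedSpace {g : G} {y : V} : y ∈ movedSpace ρ g ↔ ∃ x, ρ g x - x = y := Iff.rfl

theorem movedSpace_one : movedSpace ρ 1 = ⊥ := by
  rw [movedSpace, map_one, sub_self, LinearMap.range_zero]

theorem movedSpace_mul_le (g h : G) :
    movedSpace ρ (g * h) ≤ movedSpace ρ g ⊔ movedSpace ρ h := by
  rintro _ ⟨x, rfl⟩
  have hsum : (ρ (g * h) - 1) x = (ρ g (ρ h x) - ρ h x) + (ρ h x - x) := by simp
  rw [hsum]
  exact Submodule.add_mem_sup ⟨ρ h x, rfl⟩ ⟨x, rfl⟩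

theorem movedSpace_conj (g h : G) :
    movedSpace ρ (g * h * g⁻¹) = (movedSpace ρ h).map (ρ g) := by
  ext y
  simp only [Submodule.mem_map, mem_movedSpace, map_mul, End.mul_apply]
  constructor
  · rintro ⟨x, rfl⟩
    exact ⟨_, ⟨ρ g⁻¹ x, rfl⟩, by rw [map_sub, ρ.self_inv_apply]⟩
  · rintro ⟨_, ⟨x, rfl⟩, rfl⟩
    exact ⟨ρ g x, by rw [ρ.inv_self_apply, map_sub]⟩

theorem finrank_movedSpace_conj (g h : G) :
    finrank k (movedSpace ρ (g * h * g⁻¹)) = finrank k (movedSpace ρ h) := by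
  rw [movedSpace_conj]
  exact (Submodule.equivMapOfInjective _ (ρ.apply_bijective g).injective _).finrank_eq.symm

theorem movedSpace_conj_eq_top_iff (g : G) {h : G} :
    movedSpace ρ (g * h * g⁻¹) = ⊤ ↔ movedSpace ρ h = ⊤ := by
  have hmap : (⊤ : Submodule k V).map (ρ g) = ⊤ := by
    rw [Submodule.map_top, LinearMap.range_eq_top.2 (ρ.apply_bijective g).surjective]
  rw [movedSpace_conj]
  conv_lhs => rw [← hmap]
  exact (Submodule.map_injective_of_injective (ρ.apply_bijective g).injective).eq_iff

theorem finrank_movedSpace_mul_le [FiniteDimensional k V] (g h : G) :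
    finrank k (movedSpace ρ (g * h)) ≤
      finrank k (movedSpace ρ g) + finrank k (movedSpace ρ h) :=
  (Submodule.finrank_mono (movedSpace_mul_le g h)).trans
    (Submodule.finrank_add_le_finrank_add_finrank _ _)

theorem movedSpace_inv_mul_of_eq_neg_one {u : G} (hu : ρ u = -1) (g : G) :
    movedSpace ρ (g⁻¹ * u) = LinearMap.range (ρ g + 1) := by
  have hfactor : ρ (g⁻¹ * u) - 1 = -(ρ g + 1) * ρ g⁻¹ := by
    rw [map_mul, hu, neg_mul, add_mul, ← map_mul, mul_inv_cancel, map_one]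
    noncomm_ring
  rw [movedSpace, hfactor, End.mul_eq_comp, LinearMap.range_comp,
    LinearMap.range_eq_top.2 (ρ.apply_bijective g⁻¹).surjective, Submodule.map_top,
    LinearMap.range_neg]

theorem movedSpace_eq_top_iff_of_sq_eq_one [NeZero (2 : k)] {g : G} (hg : g ^ 2 = 1) :
    movedSpace ρ g = ⊤ ↔ ρ g = -1 := by
  have hρg : ρ g ^ 2 = 1 := by rw [← map_pow, hg, map_one]
  rw [movedSpace, range_sub_one_eq_ker_add_one hρg, LinearMap.ker_eq_top, eq_neg_iff_add_eq_zero]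

end MovedSpace

section InvariantForm

theorem exists_invariant_posDef {G V : Type*} [Group G] [Finite G] [AddCommGroup V] [Module ℝ V]
    (ρ : Representation ℝ G V) :
    ∃ q : LinearMap.BilinForm ℝ V,
      (∀ x ≠ 0, 0 < q x x) ∧ ∀ g x y, q (ρ g x) (ρ g y) = q x y := by
  cases nonempty_fintype G
  let b := Module.Free.chooseBasis ℝ V
  have : DecidableEq (Module.Free.ChooseBasisIndex ℝ V) := Classical.decEq _
  have hpos (x : V) (hx : x ≠ 0) : 0 < b.toDual x x := by
    have hsum : b.toDual x x = ∑ i ∈ (b.repr x).support, b.repr x i * b.repr x i := by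
      conv_lhs => arg 2; rw [← b.linearCombination_repr x]
      simp only [Finsupp.linearCombination_apply, Finsupp.sum, map_sum, map_smul,
        b.toDual_apply_left, smul_eq_mul]
    rw [hsum]
    refine Finset.sum_pos (fun i hi => mul_self_pos.2 (Finsupp.mem_support_iff.1 hi)) ?_
    simpa using hx
  refine ⟨∑ g : G, (b.toDual).compl₁₂ (ρ g) (ρ g), fun x hx => ?_, fun g x y => ?_⟩
  · simp only [LinearMap.sum_apply, LinearMap.compl₁₂_apply]
    refine Finset.sum_pos (fun g _ => hpos _ ?_) Finset.univ_nonempty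
    rwa [Ne, map_eq_zero_iff _ (ρ.apply_bijective g).injective]
  · simp only [LinearMap.sum_apply, LinearMap.compl₁₂_apply, ← End.mul_apply, ← map_mul]
    exact Fintype.sum_equiv (Equiv.mulRight g) _ _ fun _ => rfl

theorem orthogonal_ker_sub_one {k V : Type*} [Field k] [AddCommGroup V] [Module k V]
    [FiniteDimensional k V] {q : LinearMap.BilinForm k V} (hq : q.Nondegenerate)
    {f : End k V} (hf : ∀ x y, q (f x) (f y) = q x y) :
    q.orthogonal (LinearMap.ker (f - 1)) = LinearMap.range (f - 1) := by
  have hle : LinearMap.range (f - 1) ≤ q.orthogonal (LinearMap.ker (f - 1)) := by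
    rintro _ ⟨y, rfl⟩ x hx
    have hfx : f x = x := sub_eq_zero.1 hx
    have hxy : q x (f y) = q x y := by rw [← hf x y, hfx]
    simp [hxy]
  refine (Submodule.eq_of_le_of_finrank_eq hle ?_).symm
  rw [LinearMap.BilinForm.finrank_orthogonal hq]
  have := LinearMap.finrank_range_add_finrank_ker (f - 1)
  lia

end InvariantForm

section GeometricRepresentation

variable {B W : Type*} [Group W] {M : CoxeterMatrix B}

/-- The simple root `αᵢ`, a basis vector of the space `B →₀ ℝ` of the geometric representation. -/
noncomputable abbrev simpleRoot (i : B) : B →₀ ℝ := Finsupp.single i 1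

/-- The canonical bilinear form of a Coxeter matrix, normalized by `⟪αᵢ, αᵢ⟫ = 2`, so that
`⟪αᵢ, ·⟫` is the coroot of `αᵢ`. Off-diagonal entries `∞` are encoded as `M i j = 0`, where
`π / 0 = 0` yields the correct value `-2`. -/
noncomputable def rootForm (M : CoxeterMatrix B) : LinearMap.BilinForm ℝ (B →₀ ℝ) :=
  Finsupp.linearCombination ℝ fun i =>
    Finsupp.linearCombination ℝ fun j => -(2 * Real.cos (Real.pi / M i j))

section RootForm

variable (M)

theorem rootForm_simpleRoot_simpleRoot (i j : B) :
    rootForm M (simpleRoot i) (simpleRoot j) = -(2 * Real.cos (Real.pi / M i j)) := by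
  simp [rootForm]

theorem rootForm_simpleRoot_self (i : B) : rootForm M (simpleRoot i) (simpleRoot i) = 2 := by
  simp [rootForm_simpleRoot_simpleRoot]

theorem rootForm_comm (x y : B →₀ ℝ) : rootForm M x y = rootForm M y x := by
  suffices rootForm M = (rootForm M).flip from LinearMap.congr_fun₂ this x y
  ext i j
  simp [rootForm, M.symmetric i j]

variable {M} in
theorem rootForm_simpleRoot_ne_zero {i j : B} (h : M i j ≠ 2) :
    rootForm M (simpleRoot i) (simpleRoot j) ≠ 0 := by
  rw [rootForm_simpleRoot_simpleRoot]
  exact neg_ne_zero.2 (two_mul_cos_pi_div_ne_zero h)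

theorem isLiftable_reflection :
    M.IsLiftable fun i => reflection (rootForm_simpleRoot_self M i) := by
  intro i j
  have hsymm := rootForm_comm M (simpleRoot j) (simpleRoot i)
  have hij := rootForm_simpleRoot_simpleRoot M i j
  rcases eq_or_ne i j with rfl | hne
  · rw [M.diagonal, pow_one]
    exact mul_eq_one_iff_eq_inv.2 (reflection_inv (rootForm_simpleRoot_self M i)).symm
  rcases eq_or_ne (M i j) 0 with h0 | h0
  · rw [h0, pow_zero]
  rcases eq_or_ne (M i j) 2 with h2 | h2
  · have hzero : rootForm M (simpleRoot i) (simpleRoot j) = 0 := by rw [hij, h2]; simp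
    rw [h2]
    exact reflection_mul_reflection_sq_eq_one _ _ hzero (hsymm.trans hzero)
  · have h1 := M.off_diagonal i j hne
    refine reflection_mul_reflection_pow_eq_one _ _ (by lia) ?_
    rw [hsymm, hij]
    ring

end RootForm

/-- The geometric representation, in which `sᵢ` acts as the reflection
`x ↦ x - ⟪αᵢ, x⟫ αᵢ` for the form `rootForm M`. -/
noncomputable def geomRep (cs : CoxeterSystem M W) : Representation ℝ W (B →₀ ℝ) :=
  (LinearEquiv.automorphismGroup.toLinearMapMonoidHom (R := ℝ) (M := B →₀ ℝ)).comp
    (cs.lift ⟨_, isLiftable_reflection M⟩)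

variable (cs : CoxeterSystem M W)

local prefix:100 "s" => cs.simple
local prefix:100 "π" => cs.wordProd
local prefix:100 "ℓ" => cs.length
local notation "ρ" => geomRep cs

theorem geomRep_simple (i : B) (x : B →₀ ℝ) :
    ρ (s i) x = x - rootForm M (simpleRoot i) x • simpleRoot i := by
  rw [geomRep, MonoidHom.comp_apply, cs.lift_apply_simple]
  exact reflection_apply x (rootForm_simpleRoot_self M i)

theorem geomRep_simple_simpleRoot_self (i : B) : ρ (s i) (simpleRoot i) = -simpleRoot i := by
  rw [geomRep_simple, rootForm_simpleRoot_self]; module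

theorem rootForm_geomRep (w : W) (x y : B →₀ ℝ) :
    rootForm M (ρ w x) (ρ w y) = rootForm M x y := by
  induction w using cs.simple_induction_left generalizing x y with
  | one => simp
  | mul_simple_left w i ih =>
    simp only [map_mul, End.mul_apply, geomRep_simple, map_sub, map_smul,
      LinearMap.sub_apply, LinearMap.smul_apply, smul_eq_mul, rootForm_simpleRoot_self, ih,
      rootForm_comm M (ρ w x) (simpleRoot i)]
    ring

section RootPositivity

theorem geomRep_alternatingWord_simpleRoot (i j : B) (k : ℕ) :
    ρ (π (CoxeterSystem.alternatingWord i j k)) (simpleRoot i) =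
      (S ℝ k).eval (2 * Real.cos (Real.pi / M i j)) • simpleRoot (if Even k then i else j) +
      (S ℝ (k - 1)).eval (2 * Real.cos (Real.pi / M i j)) •
        simpleRoot (if Even k then j else i) := by
  have hij := rootForm_simpleRoot_simpleRoot M i j
  have hji := (rootForm_comm M (simpleRoot j) (simpleRoot i)).trans hij
  induction k with
  | zero => simp [CoxeterSystem.alternatingWord]
  | succ k ih =>
    rw [CoxeterSystem.alternatingWord_succ', cs.wordProd_cons, map_mul, End.mul_apply, ih]
    push_cast
    rw [S_add_one, add_sub_cancel_right]
    rcases Nat.even_or_odd k with hk | hk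
    · have hk' : ¬ Even (k + 1) := by simpa [Nat.even_add_one] using hk
      simp only [hk, hk', if_true, if_false, geomRep_simple, map_add, map_smul, hji,
        rootForm_simpleRoot_self, Polynomial.eval_sub, Polynomial.eval_mul, Polynomial.eval_X]
      module
    · have hk' : Even (k + 1) := by simpa [Nat.even_add_one] using hk
      simp only [Nat.not_even_iff_odd.2 hk, hk', if_true, if_false, geomRep_simple, map_add,
        map_smul, hij, rootForm_simpleRoot_self, Polynomial.eval_sub, Polynomial.eval_mul,
        Polynomial.eval_X]
      module

variable {cs}

theorem exists_eq_mul_alternatingWord {w : W} {i : B} (j : B) (hi : ¬ cs.IsRightDescent w i) :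
    ∃ v k, w = v * π (CoxeterSystem.alternatingWord i j k) ∧ ℓ w = ℓ v + k ∧
      ¬ cs.IsRightDescent v i ∧ ¬ cs.IsRightDescent v j := by
  induction hn : ℓ w using Nat.strong_induction_on generalizing w i j with
  | _ n ih =>
    subst hn
    by_cases hj : cs.IsRightDescent w j
    · obtain ⟨v, k, hw, hlen, hvj, hvi⟩ := ih _ hj (w := w * s j) (i := j) i
        (cs.isRightDescent_iff_not_isRightDescent_mul.1 hj) rfl
      refine ⟨v, k + 1, ?_, by rw [← cs.isRightDescent_iff.1 hj]; lia, hvi, hvj⟩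
      rw [CoxeterSystem.alternatingWord_succ, cs.wordProd_concat, ← mul_assoc, ← hw,
        cs.simple_mul_simple_cancel_right]
    · exact ⟨w, 0, by simp [CoxeterSystem.alternatingWord], rfl, hi, hj⟩

theorem succ_le_of_not_isRightDescent_mul_alternatingWord {v : W} {i j : B} {k : ℕ}
    (hlen : ℓ (v * π (CoxeterSystem.alternatingWord i j k)) = ℓ v + k)
    (hi : ¬ cs.IsRightDescent (v * π (CoxeterSystem.alternatingWord i j k)) i)
    (hM : M i j ≠ 0) : k + 1 ≤ M i j := by
  by_contra! hlt
  have hword : v * π (CoxeterSystem.alternatingWord i j k) * s i =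
      v * π (CoxeterSystem.alternatingWord j i (k + 1)) := by
    rw [CoxeterSystem.alternatingWord_succ, cs.wordProd_concat, mul_assoc]
  rw [cs.not_isRightDescent_iff, hword, hlen] at hi
  have hle := cs.length_mul_le v (π (CoxeterSystem.alternatingWord j i (k + 1)))
  have hle' := cs.length_wordProd_le (CoxeterSystem.alternatingWord j i (k + 1))
  rw [CoxeterSystem.length_alternatingWord] at hle'
  refine cs.not_isReduced_alternatingWord j i (M.symmetric i j ▸ hM)
    (M.symmetric i j ▸ hlt) ?_
  rw [CoxeterSystem.IsReduced, CoxeterSystem.length_alternatingWord]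
  lia

theorem geomRep_simpleRoot_nonneg {w : W} {i : B} (hi : ¬ cs.IsRightDescent w i) :
    0 ≤ ρ w (simpleRoot i) := by
  induction hn : ℓ w using Nat.strong_induction_on generalizing w i with
  | _ n ih =>
    subst hn
    rcases eq_or_ne w 1 with rfl | hw
    · simp
    obtain ⟨j, hj⟩ := cs.exists_rightDescent_of_ne_one hw
    have hij : i ≠ j := fun h => hi (h ▸ hj)
    obtain ⟨v, k, rfl, hlen, hvi, hvj⟩ := exists_eq_mul_alternatingWord j hi
    have hk : k ≠ 0 := by
      rintro rfl
      exact hvj (by simpa [CoxeterSystem.alternatingWord] using hj)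
    have hαi : 0 ≤ ρ v (simpleRoot i) := ih _ (by lia) hvi rfl
    have hαj : 0 ≤ ρ v (simpleRoot j) := ih _ (by lia) hvj rfl
    have hbound (hM : M i j ≠ 0) :=
      succ_le_of_not_isRightDescent_mul_alternatingWord hlen hi hM
    have hS : 0 ≤ (S ℝ k).eval (2 * Real.cos (Real.pi / M i j)) :=
      S_eval_two_mul_cos_pi_div_nonneg (M.off_diagonal i j hij) (by lia)
        fun hM => by exact_mod_cast hbound hM
    have hS' : 0 ≤ (S ℝ (k - 1)).eval (2 * Real.cos (Real.pi / M i j)) :=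
      S_eval_two_mul_cos_pi_div_nonneg (M.off_diagonal i j hij) (by lia)
        fun hM => by have := hbound hM; lia
    rw [map_mul, End.mul_apply, geomRep_alternatingWord_simpleRoot, map_add, map_smul,
      map_smul]
    split_ifs <;> exact add_nonneg (smul_nonneg hS ‹_›) (smul_nonneg hS' ‹_›)

theorem geomRep_simpleRoot_nonpos {w : W} {i : B} (hi : cs.IsRightDescent w i) :
    ρ w (simpleRoot i) ≤ 0 := by
  have := geomRep_simpleRoot_nonneg (cs.isRightDescent_iff_not_isRightDescent_mul.1 hi)
  rwa [map_mul, End.mul_apply, geomRep_simple_simpleRoot_self, map_neg,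
    Left.nonneg_neg_iff] at this

theorem isRightDescent_iff_geomRep_simpleRoot_nonpos {w : W} {i : B} :
    cs.IsRightDescent w i ↔ ρ w (simpleRoot i) ≤ 0 := by
  refine ⟨geomRep_simpleRoot_nonpos, fun hle => ?_⟩
  by_contra hi
  have hzero : ρ w (simpleRoot i) = 0 := le_antisymm hle (geomRep_simpleRoot_nonneg hi)
  rw [map_eq_zero_iff _ ((ρ).apply_bijective w).injective] at hzero
  exact one_ne_zero (Finsupp.single_eq_zero.1 hzero)

variable (cs)

theorem geomRep_injective : Function.Injective ρ := by
  refine (injective_iff_map_eq_one _).2 fun w hw => ?_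
  by_contra hne
  obtain ⟨i, hi⟩ := cs.exists_rightDescent_of_ne_one hne
  rw [isRightDescent_iff_geomRep_simpleRoot_nonpos, hw, End.one_apply] at hi
  have hle : (1 : ℝ) ≤ 0 := by simpa using hi i
  exact absurd hle (not_le.2 one_pos)

theorem simple_injective : Function.Injective cs.simple := by
  intro i j hij
  by_contra hne
  have hroot := geomRep_simple_simpleRoot_self cs j
  rw [← hij, geomRep_simple] at hroot
  have hcoord : (1 : ℝ) = -1 := by simpa [hne] using DFunLike.congr_fun hroot j
  norm_num at hcoord

include cs in
theorem finite_of_coxeterSystem [Finite W] : Finite B := Finite.of_injective _ (simple_injective cs)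

end RootPositivity

section Parabolic

open CoxeterSystem

variable {cs}

theorem simple_mem_standardParabolic {I : Set B} {i : B} (hi : i ∈ I) :
    s i ∈ cs.standardParabolic I :=
  Subgroup.subset_closure ⟨i, hi, rfl⟩

theorem geomRep_apply_eq_of_notMem {I : Set B} {w : W} (hw : w ∈ cs.standardParabolic I)
    (x : B →₀ ℝ) {b : B} (hb : b ∉ I) : ρ w x b = x b := by
  induction hw using Subgroup.closure_induction generalizing x with
  | mem w hw =>
    obtain ⟨i, hi, rfl⟩ := hw
    simp [geomRep_simple, ne_of_mem_of_not_mem hi hb]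
  | one => simp
  | mul v w _ _ hv hw => rw [map_mul, End.mul_apply, hv, hw]
  | inv w _ hw => rw [← hw (ρ w⁻¹ x), (ρ).self_inv_apply]

theorem mem_of_isRightDescent {I : Set B} {w : W} (hw : w ∈ cs.standardParabolic I) {i : B}
    (hi : cs.IsRightDescent w i) : i ∈ I := by
  by_contra hiI
  have hle := geomRep_simpleRoot_nonpos hi i
  rw [geomRep_apply_eq_of_notMem hw _ hiI, Finsupp.single_eq_same] at hle
  exact absurd hle (not_le.2 one_pos)

theorem mem_of_simpleRoot_mem_movedSpace {I : Set B} {w : W} (hw : w ∈ cs.standardParabolic I)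
    {i : B} (hi : simpleRoot i ∈ movedSpace ρ w) : i ∈ I := by
  by_contra hiI
  obtain ⟨x, hx⟩ := mem_movedSpace.1 hi
  have := DFunLike.congr_fun hx i
  rw [Finsupp.sub_apply, geomRep_apply_eq_of_notMem hw _ hiI, sub_self,
    Finsupp.single_eq_same] at this
  exact zero_ne_one this

theorem geomRep_eq_self_of_forall_rootForm_eq_zero {I : Set B} {w : W}
    (hw : w ∈ cs.standardParabolic I) {x : B →₀ ℝ}
    (hx : ∀ i ∈ I, rootForm M (simpleRoot i) x = 0) : ρ w x = x := by
  induction hw using Subgroup.closure_induction with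
  | mem _ hw =>
    obtain ⟨i, hi, rfl⟩ := hw
    rw [geomRep_simple, hx i hi, zero_smul, sub_zero]
  | one => simp
  | mul v w _ _ hv hw => rw [map_mul, End.mul_apply, hw, hv]
  | inv w _ hw => nth_rw 1 [← hw]; rw [(ρ).inv_self_apply]

variable (cs) in
theorem standardParabolic_univ : cs.standardParabolic Set.univ = ⊤ := by
  rw [standardParabolic, Set.image_univ, cs.subgroup_closure_range_simple]

theorem eq_univ_of_standardParabolic_eq_top {I : Set B} (hI : cs.standardParabolic I = ⊤) :
    I = Set.univ :=
  Set.eq_univ_iff_forall.2 fun i =>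
    mem_of_isRightDescent (w := s i) (hI ▸ Subgroup.mem_top _) (by simp [IsRightDescent])

theorem exists_mem_standardParabolic_dominant [Finite W] (I : Set B) (x : B →₀ ℝ) :
    ∃ w ∈ cs.standardParabolic I, ∀ i ∈ I, 0 ≤ rootForm M (simpleRoot i) (ρ w x) := by
  -- An element of `W_I` that maximizes the height of `w x` works.
  let height : (B →₀ ℝ) →ₗ[ℝ] ℝ := Finsupp.linearCombination ℝ fun _ => 1
  obtain ⟨⟨w, hw⟩, hmax⟩ :=
    Finite.exists_max fun w : cs.standardParabolic I => height (ρ (w : W) x)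
  refine ⟨w, hw, fun i hi => ?_⟩
  have hle := hmax ⟨s i * w, mul_mem (simple_mem_standardParabolic hi) hw⟩
  have hheight : height (simpleRoot i) = 1 := by simp [height]
  simpa only [map_mul, End.mul_apply, geomRep_simple, map_sub, map_smul, hheight,
    smul_eq_mul, mul_one, sub_le_self_iff] using hle

theorem rootForm_nonpos_of_dominant {I : Set B} {v y : B →₀ ℝ} (hv : v ≤ 0)
    (hvI : ∀ b ∉ I, v b = 0) (hy : ∀ i ∈ I, 0 ≤ rootForm M (simpleRoot i) y) :
    rootForm M v y ≤ 0 := by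
  have hsum : rootForm M v y = v.sum fun b a => a * rootForm M (simpleRoot b) y := by
    conv_lhs => rw [← Finsupp.sum_single v]
    simp only [Finsupp.sum, map_sum, LinearMap.sum_apply, ← Finsupp.smul_single_one _ (v _),
      map_smul, LinearMap.smul_apply, smul_eq_mul]
  rw [hsum]
  refine Finset.sum_nonpos fun b hb => mul_nonpos_of_nonpos_of_nonneg (hv b) (hy b ?_)
  by_contra hbI
  exact Finsupp.mem_support_iff.1 hb (hvI b hbI)

theorem mem_standardParabolic_of_fixed_dominant {I : Set B} {y : B →₀ ℝ}
    (hy : ∀ i ∈ I, 0 ≤ rootForm M (simpleRoot i) y) {w : W} (hw : w ∈ cs.standardParabolic I)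
    (hfix : ρ w y = y) :
    w ∈ cs.standardParabolic {i ∈ I | rootForm M (simpleRoot i) y = 0} := by
  induction hn : ℓ w using Nat.strong_induction_on generalizing w with
  | _ n ih =>
    subst hn
    rcases eq_or_ne w 1 with rfl | hne
    · exact one_mem _
    obtain ⟨i, hi⟩ := cs.exists_rightDescent_of_ne_one hne
    have hiI : i ∈ I := mem_of_isRightDescent hw hi
    have hzero : rootForm M (simpleRoot i) y = 0 := by
      refine le_antisymm ?_ (hy i hiI)
      rw [← rootForm_geomRep cs w, hfix]
      refine rootForm_nonpos_of_dominant (geomRep_simpleRoot_nonpos hi) (fun b hb => ?_) hy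
      rw [geomRep_apply_eq_of_notMem hw _ hb, Finsupp.single_eq_of_ne]
      exact (ne_of_mem_of_not_mem hiI hb).symm
    have hfix' : ρ (w * s i) y = y := by
      rw [map_mul, End.mul_apply, geomRep_simple, hzero, zero_smul, sub_zero, hfix]
    have hmem := ih _ hi (mul_mem hw (simple_mem_standardParabolic hiI)) hfix' rfl
    simpa using mul_mem hmem (simple_mem_standardParabolic ⟨hiI, hzero⟩)

end Parabolic

section MovedRoots

variable {cs}

theorem two_mul_apply_simpleRoot {q : LinearMap.BilinForm ℝ (B →₀ ℝ)}
    (hq : ∀ w x y, q (ρ w x) (ρ w y) = q x y) (x : B →₀ ℝ) (i : B) :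
    2 * q x (simpleRoot i) =
      rootForm M (simpleRoot i) x * q (simpleRoot i) (simpleRoot i) := by
  have h := hq (s i) x (simpleRoot i)
  rw [geomRep_simple_simpleRoot_self, geomRep_simple, map_neg, map_sub, map_smul,
    LinearMap.sub_apply, LinearMap.smul_apply, smul_eq_mul] at h
  linarith

theorem simpleRoot_mem_movedSpace_iff [Finite W] {w : W} {i : B} :
    simpleRoot i ∈ movedSpace ρ w ↔
      ∀ x, ρ w x = x → rootForm M (simpleRoot i) x = 0 := by
  have := finite_of_coxeterSystem cs
  obtain ⟨q, hpos, hinv⟩ := exists_invariant_posDef ρ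
  have hnondeg : q.Nondegenerate := by
    constructor <;> intro x hx <;> by_contra hne <;> exact (hpos x hne).ne' (hx x)
  have hαα : q (simpleRoot i) (simpleRoot i) ≠ 0 :=
    (hpos _ (Finsupp.single_ne_zero.2 one_ne_zero)).ne'
  rw [movedSpace, ← orthogonal_ker_sub_one hnondeg (hinv w)]
  refine forall_congr' fun x => imp_congr sub_eq_zero ?_
  have := two_mul_apply_simpleRoot hinv x i
  constructor
  · intro (h : q x (simpleRoot i) = 0)
    simpa [h, hαα] using this.symm
  · intro h
    simpa [h] using this

theorem rootForm_eq_zero_of_minimal [Finite W] {I : Set B} {z : W}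
    (hz : z ∈ cs.standardParabolic I)
    (hmin : ∀ J ⊆ I, ∀ g : W, g * z * g⁻¹ ∈ cs.standardParabolic J → J = I)
    {x : B →₀ ℝ} (hx : ρ z x = x) {i : B} (hi : i ∈ I) :
    rootForm M (simpleRoot i) x = 0 := by
  obtain ⟨a, ha, hdom⟩ := exists_mem_standardParabolic_dominant (cs := cs) I x
  have hfix : ρ (a * z * a⁻¹) (ρ a x) = ρ a x := by
    simp only [map_mul, End.mul_apply, (ρ).inv_self_apply, hx]
  have hJ := hmin _ (Set.sep_subset _ _) a
    (mem_standardParabolic_of_fixed_dominant hdom (mul_mem (mul_mem ha hz) (inv_mem ha)) hfix)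
  have hzero (b : B) (hb : b ∈ I) : rootForm M (simpleRoot b) (ρ a x) = 0 := (hJ.ge hb).2
  have hax : ρ a (ρ a x) = ρ a x := geomRep_eq_self_of_forall_rootForm_eq_zero ha hzero
  rw [← ((ρ).apply_bijective a).injective hax]
  exact hzero i hi

theorem exists_conj_mem_standardParabolic [Finite W] (w : W) :
    ∃ g I, g * w * g⁻¹ ∈ cs.standardParabolic I ∧
      ∀ i ∈ I, simpleRoot i ∈ movedSpace ρ (g * w * g⁻¹) := by
  have := finite_of_coxeterSystem cs
  obtain ⟨I, ⟨g, hg⟩, hmin⟩ := exists_minimal_of_wellFoundedLT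
    (fun I => ∃ g, g * w * g⁻¹ ∈ cs.standardParabolic I)
    ⟨Set.univ, 1, standardParabolic_univ cs ▸ Subgroup.mem_top _⟩
  refine ⟨g, I, hg, fun i hi => simpleRoot_mem_movedSpace_iff.2 fun x hx => ?_⟩
  refine rootForm_eq_zero_of_minimal hg (fun J hJ a ha => hJ.antisymm (hmin ⟨a * g, ?_⟩ hJ)) hx hi
  simpa [mul_assoc] using ha

theorem movedSpace_eq_top_of_forall_simpleRoot_mem {w : W}
    (h : ∀ i, simpleRoot i ∈ movedSpace ρ w) : movedSpace ρ w = ⊤ := by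
  rw [← top_le_iff, ← (Finsupp.basisSingleOne (R := ℝ) (ι := B)).span_eq, Submodule.span_le]
  rintro _ ⟨i, rfl⟩
  simpa using h i

theorem parabolicClosure_eq_top_iff_movedSpace_eq_top [Finite W] {w : W} :
    cs.parabolicClosure w = ⊤ ↔ movedSpace ρ w = ⊤ := by
  constructor
  · intro h
    obtain ⟨g, I, hmem, hmoved⟩ := exists_conj_mem_standardParabolic (cs := cs) w
    have hle : cs.parabolicClosure w ≤
        (cs.standardParabolic I).map (MulAut.conj g⁻¹).toMonoidHom :=
      sInf_le ⟨⟨I, g⁻¹, rfl⟩, _, hmem, by simp [mul_assoc]⟩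
    have hI : cs.standardParabolic I = ⊤ := by
      apply Subgroup.map_injective (f := (MulAut.conj g⁻¹).toMonoidHom) (MulAut.conj g⁻¹).injective
      rw [Subgroup.map_top_of_surjective _ (MulAut.conj g⁻¹).surjective]
      exact top_le_iff.1 (h ▸ hle)
    rw [eq_univ_of_standardParabolic_eq_top hI] at hmoved
    rw [← movedSpace_conj_eq_top_iff g]
    exact movedSpace_eq_top_of_forall_simpleRoot_mem fun i => hmoved i (Set.mem_univ i)
  · intro h
    refine top_le_iff.1 (le_sInf ?_)
    rintro _ ⟨⟨I, g, rfl⟩, z, hz, rfl⟩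
    have hzw : movedSpace ρ z = ⊤ := (movedSpace_conj_eq_top_iff g).1 h
    have hI : I = Set.univ := Set.eq_univ_iff_forall.2 fun i =>
      mem_of_simpleRoot_mem_movedSpace hz (hzw ▸ Submodule.mem_top)
    rw [hI, standardParabolic_univ]
    exact (Subgroup.map_top_of_surjective _ (MulAut.conj g).surjective).ge

end MovedRoots

section ReflectionLength

open CoxeterSystem

variable {cs}

theorem reflectionLength_prod_le {l : List W} (hl : ∀ t ∈ l, cs.IsReflection t) :
    cs.reflectionLength l.prod ≤ l.length :=
  Nat.sInf_le ⟨l, hl, rfl, rfl⟩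

theorem reflectionLength_mul_le {t : W} (ht : cs.IsReflection t) (w : W) :
    cs.reflectionLength (t * w) ≤ cs.reflectionLength w + 1 := by
  obtain ⟨l, hl, rfl, hlen⟩ := cs.exists_reflectionLength w
  have := reflectionLength_prod_le (List.forall_mem_cons.2 ⟨ht, hl⟩)
  rwa [List.prod_cons, List.length_cons, hlen] at this

theorem movedSpace_simple (i : B) : movedSpace ρ (s i) = Submodule.span ℝ {simpleRoot i} := by
  refine le_antisymm ?_ ?_
  · rintro _ ⟨x, rfl⟩
    rw [LinearMap.sub_apply, geomRep_simple, End.one_apply, sub_sub_cancel_left]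
    exact neg_mem (Submodule.smul_mem _ _ (Submodule.mem_span_singleton_self _))
  · rw [Submodule.span_singleton_le_iff_mem, mem_movedSpace]
    refine ⟨-(2 : ℝ)⁻¹ • simpleRoot i, ?_⟩
    rw [map_smul, geomRep_simple_simpleRoot_self]
    module

theorem finrank_movedSpace_reflection {t : W} (ht : cs.IsReflection t) :
    finrank ℝ (movedSpace ρ t) = 1 := by
  obtain ⟨g, i, rfl⟩ := ht
  rw [finrank_movedSpace_conj, movedSpace_simple]
  exact finrank_span_singleton (Finsupp.single_ne_zero.2 one_ne_zero)

theorem finrank_movedSpace_prod_le [Finite B] (l : List W) (hl : ∀ t ∈ l, cs.IsReflection t) :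
    finrank ℝ (movedSpace ρ l.prod) ≤ l.length := by
  induction l with
  | nil => rw [List.prod_nil, movedSpace_one, finrank_bot, List.length_nil]
  | cons t l ih =>
    obtain ⟨ht, hl⟩ := List.forall_mem_cons.1 hl
    rw [List.prod_cons, List.length_cons, add_comm, ← finrank_movedSpace_reflection ht]
    exact (finrank_movedSpace_mul_le t l.prod).trans (by gcongr; exact ih hl)

theorem ker_sub_one_lt_of_simpleRoot_mem_movedSpace {z : W} {i : B}
    (hi : simpleRoot i ∈ movedSpace ρ z) :
    LinearMap.ker (ρ z - 1) < LinearMap.ker (ρ (s i * z) - 1) := by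
  obtain ⟨x, hx⟩ := mem_movedSpace.1 hi
  have hzx : ρ z x = x + simpleRoot i := sub_eq_iff_eq_add'.1 hx
  have hpair (y : B →₀ ℝ) (hy : ρ z y = y) : rootForm M (simpleRoot i) y = 0 := by
    rw [← hx, map_sub, LinearMap.sub_apply, sub_eq_zero, ← rootForm_geomRep cs z x y, hy]
  have hpair_x : rootForm M (simpleRoot i) x = -1 := by
    have h := rootForm_geomRep cs z x x
    rw [hzx, map_add, map_add, LinearMap.add_apply, LinearMap.add_apply,
      rootForm_simpleRoot_self, rootForm_comm M x (simpleRoot i)] at h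
    linarith
  refine SetLike.lt_iff_le_and_exists.2 ⟨fun y hy => ?_, x, ?_, fun hxker => ?_⟩
  · have hzy : ρ z y = y := sub_eq_zero.1 hy
    rw [LinearMap.mem_ker, LinearMap.sub_apply, map_mul, End.mul_apply, hzy, geomRep_simple,
      hpair y hzy, zero_smul, sub_zero, End.one_apply, sub_self]
  · rw [LinearMap.mem_ker, LinearMap.sub_apply, map_mul, End.mul_apply, hzx, map_add,
      geomRep_simple, hpair_x, geomRep_simple_simpleRoot_self, End.one_apply]
    module
  · exact Finsupp.single_ne_zero.2 one_ne_zero (hx.symm.trans hxker)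

theorem finrank_movedSpace_simple_mul_lt [Finite B] {z : W} {i : B}
    (hi : simpleRoot i ∈ movedSpace ρ z) :
    finrank ℝ (movedSpace ρ (s i * z)) < finrank ℝ (movedSpace ρ z) := by
  have hlt := Submodule.finrank_lt_finrank_of_lt (ker_sub_one_lt_of_simpleRoot_mem_movedSpace hi)
  have h₁ := LinearMap.finrank_range_add_finrank_ker (ρ z - 1)
  have h₂ := LinearMap.finrank_range_add_finrank_ker (ρ (s i * z) - 1)
  rw [movedSpace, movedSpace]
  lia

theorem exists_isReflection_finrank_movedSpace_mul_lt [Finite W] {w : W} (hw : w ≠ 1) :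
    ∃ t, cs.IsReflection t ∧
      finrank ℝ (movedSpace ρ (t * w)) < finrank ℝ (movedSpace ρ w) := by
  have := finite_of_coxeterSystem cs
  obtain ⟨g, I, hmem, hmoved⟩ := exists_conj_mem_standardParabolic (cs := cs) w
  obtain ⟨i, hi⟩ : I.Nonempty := by
    by_contra! hI
    rw [hI, standardParabolic, Set.image_empty, Subgroup.closure_empty, Subgroup.mem_bot,
      conj_eq_one_iff] at hmem
    exact hw hmem
  refine ⟨g⁻¹ * s i * g, ⟨g⁻¹, i, by rw [inv_inv]⟩, ?_⟩
  rw [← finrank_movedSpace_conj g (g⁻¹ * s i * g * w), ← finrank_movedSpace_conj g w]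
  rw [show g * (g⁻¹ * s i * g * w) * g⁻¹ = s i * (g * w * g⁻¹) by group]
  exact finrank_movedSpace_simple_mul_lt (hmoved i hi)

theorem reflectionLength_eq_finrank_movedSpace [Finite W] (w : W) :
    cs.reflectionLength w = finrank ℝ (movedSpace ρ w) := by
  have := finite_of_coxeterSystem cs
  apply le_antisymm
  · induction hn : finrank ℝ (movedSpace ρ w) using Nat.strong_induction_on generalizing w with
    | _ n ih =>
      subst hn
      rcases eq_or_ne w 1 with rfl | hw
      · exact (reflectionLength_prod_le (cs := cs) (l := []) (by simp)).trans (Nat.zero_le _)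
      obtain ⟨t, ht, hlt⟩ := exists_isReflection_finrank_movedSpace_mul_lt (cs := cs) hw
      have hle := reflectionLength_mul_le ht (t * w)
      rw [← mul_assoc, ht.mul_self, one_mul] at hle
      exact hle.trans (Nat.succ_le_of_lt ((ih _ hlt _ rfl).trans_lt hlt))
  · obtain ⟨l, hl, rfl, hlen⟩ := cs.exists_reflectionLength w
    exact hlen ▸ finrank_movedSpace_prod_le l hl

theorem finrank_eq_rank : finrank ℝ (B →₀ ℝ) = cs.rank := by
  rw [rank, Module.finrank_eq_nat_card_basis Finsupp.basisSingleOne]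

theorem reflectionLength_eq_rank_iff [Finite W] {w : W} :
    cs.reflectionLength w = cs.rank ↔ movedSpace ρ w = ⊤ := by
  have := finite_of_coxeterSystem cs
  rw [reflectionLength_eq_finrank_movedSpace, ← finrank_eq_rank]
  exact ⟨Submodule.eq_top_of_finrank_eq, fun h => by rw [h, finrank_top]⟩

end ReflectionLength

section AbsoluteOrder

open CoxeterSystem

variable {cs}

theorem sq_eq_one_of_geomRep_eq_neg_one {u : W} (hu : ρ u = -1) : u ^ 2 = 1 := by
  refine geomRep_injective cs (LinearMap.ext fun x => ?_)
  simp [sq, hu]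

theorem movedSpace_le_of_absLE [Finite W] {v w : W} (h : cs.AbsLE v w) :
    movedSpace ρ v ≤ movedSpace ρ w := by
  have := finite_of_coxeterSystem cs
  rw [AbsLE] at h
  simp only [reflectionLength_eq_finrank_movedSpace] at h
  have hle : movedSpace ρ w ≤ movedSpace ρ v ⊔ movedSpace ρ (v⁻¹ * w) := by
    conv_lhs => rw [← mul_inv_cancel_left v w]
    exact movedSpace_mul_le v (v⁻¹ * w)
  rw [Submodule.eq_of_le_of_finrank_le hle (h ▸ Submodule.finrank_add_le_finrank_add_finrank _ _)]
  exact le_sup_left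

theorem absLE_one_left [Finite W] (w : W) : cs.AbsLE 1 w := by
  have := finite_of_coxeterSystem cs
  rw [AbsLE, inv_one, one_mul, reflectionLength_eq_finrank_movedSpace 1, movedSpace_one,
    finrank_bot, zero_add]

theorem absLE_iff_sq_eq_one [Finite W] {u : W} (hu : ρ u = -1) {v : W} :
    cs.AbsLE v u ↔ v ^ 2 = 1 := by
  have := finite_of_coxeterSystem cs
  have hrank : finrank ℝ (movedSpace ρ u) = finrank ℝ (B →₀ ℝ) := by
    rw [(movedSpace_eq_top_iff_of_sq_eq_one (sq_eq_one_of_geomRep_eq_neg_one hu)).2 hu,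
      finrank_top]
  rw [AbsLE, reflectionLength_eq_finrank_movedSpace, reflectionLength_eq_finrank_movedSpace,
    reflectionLength_eq_finrank_movedSpace, hrank, movedSpace_inv_mul_of_eq_neg_one hu, movedSpace,
    finrank_range_sub_one_add_finrank_range_add_one_iff, ← map_pow,
    map_eq_one_iff _ (geomRep_injective cs)]

theorem movedSpace_eq_top_of_forall_absLE [Finite W] {u : W}
    (h : ∀ t, cs.IsReflection t → cs.AbsLE t u) : movedSpace ρ u = ⊤ :=
  movedSpace_eq_top_of_forall_simpleRoot_mem fun i =>
    movedSpace_le_of_absLE (h _ (cs.isReflection_simple i)) <| by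
      rw [movedSpace_simple]
      exact Submodule.mem_span_singleton_self _

end AbsoluteOrder

section Center

open CoxeterSystem

theorem smul_geomRep_simpleRoot_of_commute {u : W} {i : B} (hui : Commute (s i) u)
    (x : B →₀ ℝ) :
    rootForm M (simpleRoot i) x • ρ u (simpleRoot i) =
      rootForm M (simpleRoot i) (ρ u x) • simpleRoot i := by
  have hcomm : ρ (s i) (ρ u x) = ρ u (ρ (s i) x) := by
    rw [← End.mul_apply, ← End.mul_apply, ← map_mul, ← map_mul, hui.eq]
  rw [geomRep_simple, geomRep_simple, map_sub, map_smul] at hcomm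
  exact (sub_right_injective hcomm).symm

variable {cs}

theorem exists_geomRep_eq_smul_one_of_mem_center (hirr : cs.IsIrreducible) {u : W}
    (hu : u ∈ Subgroup.center W) : ∃ c : ℝ, ρ u = c • 1 := by
  have hcomm (i : B) := smul_geomRep_simpleRoot_of_commute cs (Subgroup.mem_center_iff.1 hu (s i))
  have heigen (i : B) : ∃ c : ℝ, ρ u (simpleRoot i) = c • simpleRoot i := by
    have h := hcomm i (simpleRoot i)
    rw [rootForm_simpleRoot_self] at h
    exact ⟨2⁻¹ * rootForm M (simpleRoot i) (ρ u (simpleRoot i)), by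
      rw [mul_smul, ← h, inv_smul_smul₀ two_ne_zero]⟩
  choose c hc using heigen
  have hadj {i j : B} (hij : M.coxeterGraph.Adj i j) : c i = c j := by
    have h := DFunLike.congr_fun (hcomm i (simpleRoot j)) i
    rw [hc, hc, map_smul] at h
    simp only [Finsupp.smul_apply, Finsupp.single_eq_same, smul_eq_mul, mul_one] at h
    exact mul_left_cancel₀ (rootForm_simpleRoot_ne_zero hij.2) (h.trans (mul_comm _ _))
  have hconst (i j : B) : c i = c j := by
    obtain ⟨p⟩ := hirr.preconnected i j
    induction p with
    | nil => rfl
    | cons h _ ih => exact (hadj h).trans ih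
  obtain ⟨i₀⟩ := hirr.nonempty
  refine ⟨c i₀, Finsupp.lhom_ext' fun i => LinearMap.ext_ring ?_⟩
  simpa [hconst i i₀] using hc i

theorem mem_center_iff_geomRep_eq_neg_one (hirr : cs.IsIrreducible) {u : W} (hu : u ^ 2 = 1)
    (hu1 : u ≠ 1) : u ∈ Subgroup.center W ↔ ρ u = -1 := by
  refine ⟨fun hcenter => ?_, fun hneg => Subgroup.mem_center_iff.2 fun g => ?_⟩
  · obtain ⟨c, hc⟩ := exists_geomRep_eq_smul_one_of_mem_center hirr hcenter
    obtain ⟨i⟩ := hirr.nonempty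
    have hsq : c ^ 2 = 1 := by
      have h : ρ (u ^ 2) (simpleRoot i) = simpleRoot i := by rw [hu, map_one, End.one_apply]
      simpa [hc, smul_pow] using DFunLike.congr_fun h i
    rcases mul_self_eq_one_iff.1 ((sq c).symm.trans hsq) with rfl | rfl
    · refine absurd (geomRep_injective cs ?_) hu1
      rw [hc, one_smul, map_one]
    · exact hc.trans (LinearMap.ext fun x => neg_one_smul ℝ x)
  · refine geomRep_injective cs (LinearMap.ext fun x => ?_)
    simp [hneg]

end Center

section LongestElement

open CoxeterSystem

variable {cs}

theorem isRightDescent_mul_iff_of_geomRep_eq_neg_one {u : W} (hu : ρ u = -1) {v : W} {i : B} :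
    cs.IsRightDescent (u * v) i ↔ ¬ cs.IsRightDescent v i := by
  have hneg : ρ (u * v) (simpleRoot i) = -ρ v (simpleRoot i) := by
    rw [map_mul, End.mul_apply, hu, LinearMap.neg_apply, End.one_apply]
  refine ⟨fun h hv => ?_, fun hv => ?_⟩
  · have hnonneg := geomRep_simpleRoot_nonpos h
    rw [hneg, Left.neg_nonpos_iff] at hnonneg
    have hzero := le_antisymm (geomRep_simpleRoot_nonpos hv) hnonneg
    rw [map_eq_zero_iff _ ((ρ).apply_bijective v).injective] at hzero
    exact one_ne_zero (Finsupp.single_eq_zero.1 hzero)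
  · rw [isRightDescent_iff_geomRep_simpleRoot_nonpos, hneg, Left.neg_nonpos_iff]
    exact geomRep_simpleRoot_nonneg hv

theorem length_mul_add_length_of_geomRep_eq_neg_one {u : W} (hu : ρ u = -1) (v : W) :
    ℓ (u * v) + ℓ v = ℓ u := by
  induction v using cs.simple_induction_right with
  | one => simp
  | mul_simple_right v i ih =>
    rw [← mul_assoc]
    have hiff := isRightDescent_mul_iff_of_geomRep_eq_neg_one hu (v := v) (i := i)
    by_cases hv : cs.IsRightDescent v i
    · have h₁ := cs.isRightDescent_iff.1 hv
      have h₂ := cs.not_isRightDescent_iff.1 fun h => hiff.1 h hv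
      lia
    · have h₁ := cs.not_isRightDescent_iff.1 hv
      have h₂ := cs.isRightDescent_iff.1 (hiff.2 hv)
      lia

theorem isLongestElement_of_geomRep_eq_neg_one {u : W} (hu : ρ u = -1) :
    cs.IsLongestElement u := by
  intro v hv
  have hlen := length_mul_add_length_of_geomRep_eq_neg_one hu v
  have hpos : ℓ (u * v) ≠ 0 := by
    rw [Ne, cs.length_eq_zero_iff]
    intro huv
    have huu : u * u = 1 := by rw [← sq, sq_eq_one_of_geomRep_eq_neg_one hu]
    exact hv (mul_left_cancel (huv.trans huu.symm))
  lia

end LongestElement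

end GeometricRepresentation

end CoxeterGeometry

open CoxeterGeometry

theorem mainTheorem6 {B W : Type*} [Group W] [Finite W] {M : CoxeterMatrix B}
    (cs : CoxeterSystem M W) (hirr : cs.IsIrreducible)
    (u : W) (hu : u ^ 2 = 1) (hu1 : u ≠ 1) :
    [cs.parabolicClosure u = ⊤,
      ∀ t : W, cs.IsReflection t → cs.AbsLE t u,
      u ∈ Subgroup.center W,
      cs.reflectionLength u = cs.rank].TFAE ∧
    (cs.parabolicClosure u = ⊤ →
      cs.IsLongestElement u ∧ cs.absInterval 1 u = {v : W | v ^ 2 = 1}) := by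
  have hneg : movedSpace (geomRep cs) u = ⊤ ↔ geomRep cs u = -1 :=
    movedSpace_eq_top_iff_of_sq_eq_one hu
  rw [mem_center_iff_geomRep_eq_neg_one hirr hu hu1, ← hneg,
    parabolicClosure_eq_top_iff_movedSpace_eq_top, reflectionLength_eq_rank_iff]
  refine ⟨?_, fun h => ⟨isLongestElement_of_geomRep_eq_neg_one (hneg.1 h), ?_⟩⟩
  · tfae_have 1 → 2 := fun h t ht => (absLE_iff_sq_eq_one (hneg.1 h)).2 (by rw [sq, ht.mul_self])
    tfae_have 2 → 1 := movedSpace_eq_top_of_forall_absLE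
    tfae_have 1 ↔ 3 := Iff.rfl
    tfae_have 1 ↔ 4 := Iff.rfl
    tfae_finish
  · ext v
    exact (and_iff_right (absLE_one_left v)).trans (absLE_iff_sq_eq_one (hneg.1 h))
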